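/- Let $0<b<a$ be real numbers, let $\eta_n=(-1)^{s(n)}$ where $s(n)$ is the sum of the binary digits of $n$, and put $f(n)=\sum_{0\le m<n}\bigl(\tfrac{a+b}{2}+\tfrac{a-b}{2}\eta_m\bigr)$ for $n\ge 1$. Consider the Dirac comb $\mu=\sum_{n\ge1}\delta_{f(n)}$. An averaging sequence of finite approximants is $\mathcal U=(U_l)_{l\ge0}$ with $U_l=\rho_lJ\cap\{f(n): n\ge1\}$, where $J$ is a compact interval whose interior contains $0$ and $(\rho_l)$ is a strictly increasing sequence of positive reals tending to $+\infty$. Put $$\nu_{\mathcal U,l}(k)=\frac1{\mathrm{card}(U_l)}\Bigl|\sum_{f(n)\in U_l}e^{-ikf(n)}\Bigr|^2 .$$ An AGL exponent at $k$ is an $\alpha\in(-1,1)$ such that, for every averaging sequence $\mathcal U$, the numbers $L^-=\liminf_l \nu_{\mathcal U,l}(k)/\mathrm{card}(U_l)^{\alpha}$ and $L^+=\limsup_l \nu_{\mathcal U,l}(k)/\mathrm{card}(U_l)^{\alpha}$ satisfy $0<L^-\le L^+<\infty$ if $L^-\ne0$, and $0<L^+<\infty$ if $L^-=0$. For a given $\alpha$,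 an averaging sequence $\mathcal V$ has the extinction property at $k$ if $\nu_{\mathcal V,i}(k)/\mathrm{card}(V_i)^{\alpha}\to0$ as $i\to\infty$. For $m\in\mathbb Z$ let $c_m(k)=\int_0^1 e^{-2ik(a-b)x}e^{-2\pi imx}\,dx$, and let $\kappa_\eta(k)=\lim_{N\to\infty}\sum_{|m|\le N,\ m\text{ odd}}c_m(k)$. Let $\mathbb S$ be the set of all $k=\frac{4\pi}{a+b}\frac{t}{2^hp}$ with $t\in\mathbb Z$, $h\ge0$, $p\ge3$ odd, $\gcd(t,2^hp)=1$ and $\kappa_\eta(k)\ne0$. For odd $p\ge3$ let $S_{p,i}(n)=\sum_{0\le j<n,\ j\equiv i\,(p)}\eta_j$, let $s$ be the order of $2$ modulo $p$, let $\lambda_1$ be the largest modulus of an eigenvalue of the matrix $(S_{p,i-j}(2^s))_{0\le i,j\le p-1}$, and let $\beta=\frac{\log\lambda_1}{s\log2}$. Let $r$ be the least positive integer with $z^r=\lambda_1^r$ for all eigenvalues $z$ of modulus $\lambda_1$. For $0\le j<p$ let $$\psi_{p,j}(x)=\lim_{m\to\infty}\frac{S_{p,j}\bigl(\lfloor 2^{rs(x+m)}\rfloor\bigr)}{2^{rs(x+m)\beta}},$$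 which is the function of period $1$ with $S_{p,j}(n)=n^\beta\psi_{p,j}\bigl(\frac{\log n}{rs\log 2}\bigr)+o(n^\beta)$. For $k=\frac{4\pi}{a+b}\frac tp$ with $\gcd(t,p)=1$, the rarefaction domain is $$R(k)=\Bigl\{\sum_{j=0}^{p-1}y_j\,e^{-2\pi ijt/p}\ :\ \inf_{[0,1]}\psi_{p,j}\le y_j\le\sup_{[0,1]}\psi_{p,j}\Bigr\}.$$ Let $p\ge3$ be odd, $\gcd(t,p)=1$ and $k=\frac{4\pi}{a+b}\frac tp\in\mathbb S$. If $0\notin R(k)$, then $\alpha=2\beta-1$ is the unique AGL exponent at $k$, and no averaging sequence of finite approximants has the extinction property at $k$ for this $\alpha$. -/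

import Mathlib

namespace ThueMorse

noncomputable section

/-- The `±1` Prouhet-Thue-Morse sequence `η_n = (-1)^{s(n)}`, `s(n)` the binary sum of digits. -/
def eta (n : ℕ) : ℤ := (-1) ^ (Nat.digits 2 n).sum

/-- `f(n) = ∑_{0 ≤ m < n} ((a+b)/2 + (a-b)/2 · η_m)` for `n ≥ 0`, extended to `ℤ` as an odd
function. -/
def f (a b : ℝ) (n : ℤ) : ℝ :=
  (n.sign : ℝ) * ∑ m ∈ Finset.range n.natAbs, ((a + b) / 2 + (a - b) / 2 * (eta m : ℝ))

/-- The weight of the Dirac comb `μ = ∑_{n ≥ 1} δ_{f(n)}`. -/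
def weight (n : ℤ) : ℂ := if 1 ≤ n then 1 else 0

/-- The points of the Thue-Morse quasicrystal that carry a nonzero weight. -/
def weightedPoints (a b : ℝ) : Set ℝ := f a b '' Function.support weight

/-- The data of an averaging sequence: a compact interval `J = [lo, hi]` whose interior contains
the origin, and a strictly increasing sequence of positive dilation factors tending to infinity. -/
structure AveragingSequence where
  lo : ℝ
  hi : ℝ
  lo_neg : lo < 0
  hi_pos : 0 < hi
  ρ : ℕ → ℝ
  ρ_pos : ∀ l, 0 < ρ l
  ρ_strictMono : StrictMono ρ
  ρ_tendsto : Filter.Tendsto ρ Filter.atTop Filter.atTop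

/-- The finite approximant `U_l = ρ_l J ∩ Λ^{supp(ω)}`. -/
def AveragingSequence.approximant (U : AveragingSequence) (a b : ℝ) (l : ℕ) : Set ℝ :=
  ((fun x : ℝ => U.ρ l * x) '' Set.Icc U.lo U.hi) ∩ weightedPoints a b

/-- The density at `k` of the `l`-th approximant measure:
`(1 / card U_l) |∑_{f(n) ∈ U_l} ω(n) e^{-i k f(n)}|^2`. -/
def nu (a b : ℝ) (U : AveragingSequence) (l : ℕ) (k : ℝ) : ℝ :=
  (1 / ((U.approximant a b l).ncard : ℝ)) *
    ‖∑ᶠ (n : ℤ) (_ : f a b n ∈ U.approximant a b l),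
        weight n * Complex.exp (-(Complex.I * (k : ℂ) * (f a b n : ℂ)))‖ ^ 2

/-- The normalized approximant density `ν_{U,l}(k) / card(U_l)^α`. -/
def nuNormalized (a b : ℝ) (U : AveragingSequence) (α : ℝ) (l : ℕ) (k : ℝ) : ℝ :=
  nu a b U l k / ((U.approximant a b l).ncard : ℝ) ^ α

/-- The Aubry-Godrèche-Luck condition: `α ∈ (-1, 1)` is a scaling exponent at `k`. -/
def IsAGLExponent (a b k α : ℝ) : Prop :=
  α ∈ Set.Ioo (-1 : ℝ) 1 ∧
  ∀ U : AveragingSequence,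
    let inf := Filter.liminf (fun l => ENNReal.ofReal (nuNormalized a b U α l k)) Filter.atTop
    let sup := Filter.limsup (fun l => ENNReal.ofReal (nuNormalized a b U α l k)) Filter.atTop
    (inf ≠ 0 → 0 < inf ∧ inf ≤ sup ∧ sup < ⊤) ∧ (inf = 0 → 0 < sup ∧ sup < ⊤)

/-- The extinction property at `k` of an averaging sequence, for the exponent `α`. -/
def HasExtinctionProperty (a b k α : ℝ) (V : AveragingSequence) : Prop :=
  Filter.Tendsto (fun i => nuNormalized a b V α i k) Filter.atTop (nhds 0)

/-- The Fourier coefficients `c_m(k)` of the 1-periodic function `x ↦ e^{-i k α₂ {x}}`, where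
`α₂ = 2(a - b)` and `{x}` is the fractional part. -/
def fourierCoefficient (a b : ℝ) (m : ℤ) (k : ℝ) : ℂ :=
  ∫ x in (0 : ℝ)..1,
    Complex.exp (-(Complex.I * (k : ℂ) * ((2 * (a - b) : ℝ) : ℂ) * ((Int.fract x : ℝ) : ℂ))) *
      Complex.exp (-(2 * (Real.pi : ℂ) * Complex.I * (m : ℂ) * (x : ℂ)))

/-- `κ_η(k) = ∑_{m odd} c_m(k)`, summed symmetrically as is usual for Fourier series (the series is
only conditionally convergent). -/
def kappaEta (a b k : ℝ) : ℂ :=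
  Filter.limUnder Filter.atTop (fun N : ℕ =>
    ∑ m ∈ (Finset.Icc (-(N : ℤ)) (N : ℤ)).filter (fun m => Odd m), fourierCoefficient a b m k)

/-- The set `𝕊` of wave vectors `(4π/(a+b)) · t/(2^h p)` with `p ≥ 3` odd, `gcd(t, 2^h p) = 1` and
`κ_η ≠ 0`. -/
def singularSet (a b : ℝ) : Set ℝ :=
  {k | ∃ (t : ℤ) (p h : ℕ), Odd p ∧ 3 ≤ p ∧ IsCoprime t ((2 : ℤ) ^ h * (p : ℤ)) ∧
    k = 4 * Real.pi / (a + b) * ((t : ℝ) / (2 ^ h * (p : ℝ))) ∧ kappaEta a b k ≠ 0}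

/-- The `p`-rarefied sum `S_{p,i}(n) = ∑_{0 ≤ j < n, j ≡ i (mod p)} η_j`. -/
def rarefiedSum (p : ℕ) (i : ℤ) (n : ℕ) : ℤ :=
  ∑ j ∈ (Finset.range n).filter (fun j : ℕ => (j : ℤ) ≡ i [ZMOD (p : ℤ)]), eta j

/-- `s`, the order of `2` modulo `p`. -/
def orderTwo (p : ℕ) : ℕ := orderOf (2 : ZMod p)

/-- The matrix `M = (S_{p,i-j}(2^s))_{0 ≤ i,j ≤ p-1}`. -/
def rarefactionMatrix (p : ℕ) : Matrix (Fin p) (Fin p) ℂ :=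
  Matrix.of fun i j => (rarefiedSum p ((i : ℤ) - (j : ℤ)) (2 ^ orderTwo p) : ℂ)

/-- `λ₁`, the largest modulus of an eigenvalue of `M`. -/
def lambdaOne (p : ℕ) : ℝ := sSup ((fun z : ℂ => ‖z‖) '' spectrum ℂ (rarefactionMatrix p))

/-- The exponent `β = log λ₁ / (s log 2)`. -/
def beta (p : ℕ) : ℝ := Real.log (lambdaOne p) / ((orderTwo p : ℝ) * Real.log 2)

/-- The exponent `α = 2β - 1`. -/
def alpha (p : ℕ) : ℝ := 2 * beta p - 1

/-- `r`, the least positive integer such that `z^r = λ₁^r` for every eigenvalue `z` of `M` of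
maximal modulus. -/
def rIndex (p : ℕ) : ℕ :=
  sInf {r : ℕ | 0 < r ∧ ∀ z ∈ spectrum ℂ (rarefactionMatrix p),
    ‖z‖ = lambdaOne p → z ^ r = (lambdaOne p : ℂ) ^ r}

/-- The fractal function `ψ_{p,j}` of period 1 governing the rarefied sums,
`S_{p,j}(n) = n^β ψ_{p,j}(log n / (r s log 2)) + o(n^β)`. It is given explicitly as the limit of
`S_{p,j}(⌊X_m⌋) / X_m^β` for `X_m = 2^{r s (x + m)}`, that is `log X_m / (r s log 2) = x + m`; a
continuous function of period 1 with the displayed asymptotics has to be this limit. -/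
def psi (p j : ℕ) (x : ℝ) : ℝ :=
  Filter.limUnder Filter.atTop (fun m : ℕ =>
    (rarefiedSum p (j : ℤ) ⌊(2 : ℝ) ^ ((rIndex p : ℝ) * (orderTwo p : ℝ) * (x + (m : ℝ)))⌋₊ : ℝ) /
      ((2 : ℝ) ^ ((rIndex p : ℝ) * (orderTwo p : ℝ) * (x + (m : ℝ)))) ^ beta p)

/-- The rarefaction domain `R(k)` at `k = (4π/(a+b)) t/p`: all sums `∑_{j<p} y_j ξ^j` with
`ξ = e^{-2πi t/p}` and `y_j` between the infimum and the supremum of `ψ_{p,j}` on `[0,1]`. -/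
def rarefactionDomain (p : ℕ) (t : ℤ) : Set ℂ :=
  {z | ∃ y : Fin p → ℝ,
    (∀ j : Fin p, y j ∈ Set.Icc (sInf (psi p j '' Set.Icc 0 1)) (sSup (psi p j '' Set.Icc 0 1))) ∧
    z = ∑ j : Fin p, (y j : ℂ) *
      Complex.exp (-(2 * (Real.pi : ℂ) * Complex.I * (t : ℂ) / (p : ℂ))) ^ (j : ℕ)}

end

end ThueMorse

namespace ThueMorse

/-! ### Thue-Morse exponential sums and their self-similarity -/

noncomputable section
open Finset

/-! Everything rests on the exact order of F(n) = ∑_{1 ≤ i ≤ n} e^{-ikf(i)}. The points f(n), n ≥ 1,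
are positive and increasing, so each approximant is an initial segment f(1), …, f(n). If |F(n)| has
exact order n^β, the normalized density has exact order n^(2β-1-α) along every averaging sequence,
and this stays away from 0 and ∞ only for α = 2β-1.

Since f(2m) = (a+b)m, with ξ = e^{-2πit/p} the even points contribute ξ^(2m), and the odd points
contribute ξ^(2m+1) times a phase depending only on η_m. Summing, F(n) = c ∑_{m<n} η_m ξ^m + O(1),
where c is a nonzero multiple of sin(k(a-b)/2) (`exists_norm_sum_exp_sub_le`). If this sine
vanished, so would every odd Fourier coefficient, against κ_η(k) ≠ 0.

For z^p = 1, write E_z(n) = ∑_{m<n} η_m z^m. Concatenation of binary digits and 2^s ≡ 1 mod p give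
E_z(2^(sr) N + c) = E_z(2^s)^r E_z(N) + O(1) for 0 ≤ c ≤ 2^(sr). The numbers E_z(2^s) are the
eigenvalues of the circulant matrix M, and the choice of r makes each E_z(2^s)^r either equal to
λ₁^r or smaller in modulus. So the normalized sums converge along X·2^(rsm), uniformly in X, and
Fourier inversion yields ψ_{p,j}. Hence n^(-β) E_ξ(n) approaches the compact set R(k); as 0 ∉ R(k),
it is bounded above and below (`exists_norm_expSum_xi_bounds`). Finally 1 < λ₁ < 2^s places β in
(0,1), so that n^β dominates the bounded errors. -/

theorem eta_zero : eta 0 = 1 := by simp [eta]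

theorem eta_two_mul (n : ℕ) : eta (2 * n) = eta n := by
  rcases Nat.eq_zero_or_pos n with rfl | hn
  · simp
  · unfold eta
    rw [Nat.digits_def' (by norm_num) (by omega)]
    simp

theorem eta_two_mul_add_one (n : ℕ) : eta (2 * n + 1) = -eta n := by
  unfold eta
  rw [Nat.digits_def' (by norm_num) (by omega)]
  have h1 : (2 * n + 1) % 2 = 1 := by omega
  have h2 : (2 * n + 1) / 2 = n := by omega
  rw [h1, h2, List.sum_cons, pow_add]
  ring

/-- For c < 2^s the addition has no carries, so the binary digit sums of N and c add up. -/
theorem eta_two_pow_mul_add (s : ℕ) : ∀ N c : ℕ, c < 2 ^ s →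
    eta (2 ^ s * N + c) = eta N * eta c := by
  induction s with
  | zero => intro N c hc; obtain rfl : c = 0 := by simpa using hc
            simp [eta_zero]
  | succ s ih =>
    intro N c hc
    rw [pow_succ] at hc
    obtain ⟨d, rfl | rfl⟩ : ∃ d, c = 2 * d ∨ c = 2 * d + 1 := ⟨c / 2, by omega⟩
    · rw [show 2 ^ (s + 1) * N + 2 * d = 2 * (2 ^ s * N + d) by ring, eta_two_mul, eta_two_mul,
        ih N d (by omega)]
    · rw [show 2 ^ (s + 1) * N + (2 * d + 1) = 2 * (2 ^ s * N + d) + 1 by ring,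
        eta_two_mul_add_one, eta_two_mul_add_one, ih N d (by omega)]
      ring

theorem eta_eq_one_or (n : ℕ) : eta n = 1 ∨ eta n = -1 := neg_one_pow_eq_or ℤ _

theorem norm_eta (n : ℕ) : ‖(eta n : ℂ)‖ = 1 := by
  rcases eta_eq_one_or n with h | h <;> simp [h]

/-- The exponential sum `∑_{m < n} η_m z^m`. -/
def expSum (z : ℂ) (n : ℕ) : ℂ := ∑ m ∈ range n, (eta m : ℂ) * z ^ m

theorem norm_expSum_le {z : ℂ} (hz : ‖z‖ = 1) (n : ℕ) : ‖expSum z n‖ ≤ n := by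
  unfold expSum
  refine (norm_sum_le _ _).trans ?_
  simp only [norm_mul, norm_eta, norm_pow, hz, one_pow, mul_one, sum_const, card_range,
    nsmul_eq_mul, le_refl]

theorem expSum_block (z : ℂ) (s N c : ℕ) (hc : c ≤ 2 ^ s) :
    expSum z (2 ^ s * N + c) =
      expSum z (2 ^ s * N) + eta N * z ^ (2 ^ s * N) * expSum z c := by
  unfold expSum
  rw [sum_range_add, mul_sum]
  congr 1
  refine sum_congr rfl fun i hi => ?_
  rw [eta_two_pow_mul_add s N i ((mem_range.1 hi).trans_le hc), pow_add]
  push_cast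
  ring

theorem expSum_two_pow_mul (z : ℂ) (s N : ℕ) :
    expSum z (2 ^ s * N) = expSum z (2 ^ s) * expSum (z ^ 2 ^ s) N := by
  induction N with
  | zero => simp [expSum]
  | succ N ih =>
    rw [mul_add, mul_one, expSum_block z s N _ le_rfl, ih]
    simp only [expSum, sum_range_succ, pow_mul]
    ring

theorem expSum_two_mul (z : ℂ) (N : ℕ) : expSum z (2 * N) = (1 - z) * expSum (z ^ 2) N := by
  have h := expSum_two_pow_mul z 1 N
  have h2 : expSum z 2 = 1 - z := by
    have := eta_two_mul_add_one 0
    simp [expSum, sum_range_succ, eta_zero] at this ⊢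
    simp [this]; ring
  simpa [h2] using h

theorem expSum_two_pow (s : ℕ) : ∀ z : ℂ, expSum z (2 ^ s) = ∏ i ∈ range s, (1 - z ^ 2 ^ i) := by
  induction s with
  | zero => intro z; simp [expSum, eta_zero]
  | succ s ih =>
    intro z
    rw [pow_succ', expSum_two_mul, ih, prod_range_succ', mul_comm]
    congr 1
    · exact prod_congr rfl fun i _ => by rw [← pow_mul, ← pow_succ']
    · simp

theorem orderTwo_pos {p : ℕ} (hp : Odd p) : 0 < orderTwo p := by
  have hc : Nat.Coprime 2 p := (Nat.coprime_two_left).2 hp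
  have := ZMod.pow_totient (ZMod.unitOfCoprime 2 hc)
  have h2 : (2 : ZMod p) ^ p.totient = 1 := by
    have := congrArg Units.val this
    rwa [Units.val_pow_eq_pow_val, ZMod.coe_unitOfCoprime, Units.val_one, Nat.cast_ofNat] at this
  exact orderOf_pos_iff.2 (isOfFinOrder_iff_pow_eq_one.2 ⟨_, Nat.totient_pos.2 hp.pos, h2⟩)

/-- As 2^s ≡ 1 mod p, the map z ↦ z^(2^s) fixes every p-th root of unity; this closes the block
recursion on a single z. -/
theorem pow_two_pow_mul_orderTwo {p : ℕ} {z : ℂ} (hz : z ^ p = 1) (r : ℕ) :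
    z ^ 2 ^ (orderTwo p * r) = z := by
  have h : ((2 ^ (orderTwo p * r) : ℕ) : ZMod p) = (1 : ℕ) := by
    push_cast
    rw [pow_mul, orderTwo, pow_orderOf_eq_one, one_pow]
  rw [ZMod.natCast_eq_natCast_iff] at h
  have h1 : 1 ≤ 2 ^ (orderTwo p * r) := Nat.one_le_two_pow
  obtain ⟨d, hd⟩ := (Nat.modEq_iff_dvd' h1).1 h.symm
  have : 2 ^ (orderTwo p * r) = p * d + 1 := by omega
  rw [this, pow_succ, pow_mul, hz, one_pow, one_mul]

theorem expSum_two_pow_orderTwo_mul {p : ℕ} {z : ℂ} (hz : z ^ p = 1) (r : ℕ) :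
    expSum z (2 ^ (orderTwo p * r)) = expSum z (2 ^ orderTwo p) ^ r := by
  induction r with
  | zero => simp [expSum, eta_zero]
  | succ r ih =>
    rw [mul_add, mul_one, pow_add, expSum_two_pow_mul, pow_two_pow_mul_orderTwo hz, ih, pow_succ]

/-- The self-similarity of the exponential sums, up to a bounded error. -/
theorem norm_expSum_sub_le {p : ℕ} {z : ℂ} (hp : p ≠ 0) (hz : z ^ p = 1) (r N c : ℕ)
    (hc : c ≤ 2 ^ (orderTwo p * r)) :
    ‖expSum z (2 ^ (orderTwo p * r) * N + c) - expSum z (2 ^ orderTwo p) ^ r * expSum z N‖ ≤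
      2 ^ (orderTwo p * r) := by
  have h1 : ‖z‖ = 1 := Complex.norm_eq_one_of_pow_eq_one hz hp
  rw [expSum_block _ _ _ _ hc, expSum_two_pow_mul, expSum_two_pow_orderTwo_mul hz,
    pow_two_pow_mul_orderTwo hz, add_sub_cancel_left, norm_mul, norm_mul, norm_eta, norm_pow, h1,
    one_pow, one_mul, one_mul]
  exact (norm_expSum_le h1 c).trans (by exact_mod_cast hc)

/-- Regrouping by residues modulo `p`. -/
theorem sum_rarefiedSum_sub_mul_pow {p : ℕ} (hp : 0 < p) {z : ℂ} (hz : z ^ p = 1) (j n : ℕ) :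
    ∑ i : Fin p, (rarefiedSum p ((i : ℤ) - (j : ℤ)) n : ℂ) * z ^ (i : ℕ) = z ^ j * expSum z n := by
  unfold rarefiedSum expSum
  simp only [Int.cast_sum, sum_filter, sum_mul, mul_sum]
  rw [sum_comm]
  refine sum_congr rfl fun m _ => ?_
  have hlt : (m + j) % p < p := Nat.mod_lt _ hp
  rw [Finset.sum_eq_single (⟨(m + j) % p, hlt⟩ : Fin p)]
  · have : (m : ℤ) ≡ ((m + j) % p : ℕ) - (j : ℤ) [ZMOD p] := by
      have : ((m + j : ℕ) : ℤ) ≡ ((m + j) % p : ℕ) [ZMOD p] :=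
        (Int.natCast_modEq_iff.2 (Nat.mod_modEq _ _)).symm
      have := this.sub_right (j : ℤ)
      push_cast at this ⊢
      simpa using this
    simp only [this, if_true]
    rw [← pow_eq_pow_mod (m + j) hz, pow_add]
    ring
  · intro i _ hi
    rw [if_neg, Int.cast_zero, zero_mul]
    intro h
    apply hi
    have h2 := h.add_right (j : ℤ)
    rw [sub_add_cancel] at h2
    have h3 : m + j ≡ i [MOD p] := by exact_mod_cast h2
    ext
    have := h3.symm
    rw [Nat.ModEq, Nat.mod_eq_of_lt i.2] at this
    simpa using this
  · simp

end

/-! ### Spectrum of the rarefaction matrix: λ₁, r and β -/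

noncomputable section
open Finset Matrix

theorem vecMul_rarefactionMatrix {p : ℕ} (hp : 0 < p) {z : ℂ} (hz : z ^ p = 1) :
    (fun i : Fin p => z ^ (i : ℕ)) ᵥ* rarefactionMatrix p =
      expSum z (2 ^ orderTwo p) • fun i : Fin p => z ^ (i : ℕ) := by
  ext j
  simp only [vecMul, dotProduct, rarefactionMatrix, of_apply, Pi.smul_apply, smul_eq_mul]
  rw [mul_comm, ← sum_rarefiedSum_sub_mul_pow hp hz]
  exact sum_congr rfl fun i _ => mul_comm _ _

theorem mem_spectrum_iff_det {p : ℕ} (μ : ℂ) (A : Matrix (Fin p) (Fin p) ℂ) :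
    μ ∈ spectrum ℂ A ↔ (algebraMap ℂ (Matrix (Fin p) (Fin p) ℂ) μ - A).det = 0 := by
  rw [spectrum.mem_iff, Matrix.isUnit_iff_isUnit_det, isUnit_iff_ne_zero, not_not]

/-- The eigenvalues of the circulant matrix are the exponential sums at the `p`-th roots of unity. -/
theorem mem_spectrum_rarefactionMatrix {p : ℕ} (hp : 0 < p) (μ : ℂ) :
    μ ∈ spectrum ℂ (rarefactionMatrix p) ↔ ∃ z : ℂ, z ^ p = 1 ∧ μ = expSum z (2 ^ orderTwo p) := by
  rw [mem_spectrum_iff_det]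
  constructor
  · intro h
    obtain ⟨v, hv0, hv⟩ := exists_mulVec_eq_zero_iff.2 h
    by_contra! hne
    apply hv0
    have hw := Complex.isPrimitiveRoot_exp p hp.ne'
    -- Pairing a kernel vector with each left eigenvector (z^i) shows that all its discrete Fourier
    -- coefficients vanish; a Vandermonde argument then kills the vector.
    refine eq_zero_of_forall_index_sum_pow_mul_eq_zero
      (f := fun l : Fin p => Complex.exp (2 * Real.pi * Complex.I / p) ^ (l : ℕ)) ?_ ?_
    · intro l l' hl
      exact Fin.ext (hw.pow_inj l.2 l'.2 hl)
    · intro l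
      set z := Complex.exp (2 * Real.pi * Complex.I / p) ^ (l : ℕ) with hzdef
      have hz : z ^ p = 1 := by rw [hzdef, pow_right_comm, hw.pow_eq_one, one_pow]
      have h1 : (fun i : Fin p => z ^ (i : ℕ)) ⬝ᵥ
          ((algebraMap ℂ (Matrix (Fin p) (Fin p) ℂ) μ - rarefactionMatrix p) *ᵥ v) = 0 := by
        rw [hv, dotProduct_zero]
      rw [dotProduct_mulVec, vecMul_sub, vecMul_rarefactionMatrix hp hz, Algebra.algebraMap_eq_smul_one,
        vecMul_smul, vecMul_one, ← sub_smul, smul_dotProduct, smul_eq_mul, mul_eq_zero, sub_eq_zero] at h1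
      exact h1.resolve_left (hne z hz)
  · rintro ⟨z, hz, rfl⟩
    refine exists_vecMul_eq_zero_iff.1 ⟨fun i : Fin p => z ^ (i : ℕ), ?_, ?_⟩
    · intro h
      have := congrFun h ⟨0, hp⟩
      simp at this
    · rw [vecMul_sub, vecMul_rarefactionMatrix hp hz, Algebra.algebraMap_eq_smul_one,
        vecMul_smul, vecMul_one, sub_self]

theorem norm_expSum_le_lambdaOne {p : ℕ} (hp : 0 < p) {z : ℂ} (hz : z ^ p = 1) :
    ‖expSum z (2 ^ orderTwo p)‖ ≤ lambdaOne p :=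
  le_csSup ((Matrix.finite_spectrum _).image _).bddAbove
    ⟨_, (mem_spectrum_rarefactionMatrix hp _).2 ⟨z, hz, rfl⟩, rfl⟩

theorem exists_norm_expSum_eq_lambdaOne {p : ℕ} (hp : 0 < p) :
    ∃ z : ℂ, z ^ p = 1 ∧ ‖expSum z (2 ^ orderTwo p)‖ = lambdaOne p := by
  have hne : ((fun z : ℂ => ‖z‖) '' spectrum ℂ (rarefactionMatrix p)).Nonempty :=
    ⟨_, _, (mem_spectrum_rarefactionMatrix hp _).2 ⟨1, one_pow p, rfl⟩, rfl⟩
  obtain ⟨μ, hμ, h⟩ := hne.csSup_mem ((Matrix.finite_spectrum _).image _)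
  obtain ⟨z, hz, rfl⟩ := (mem_spectrum_rarefactionMatrix hp _).1 hμ
  exact ⟨z, hz, h⟩

/-- The product of the eigenvalues at the nontrivial p-th roots of unity is p^s > 1: for each of the
s exponents i, the factors 1 - z^(2^i) multiply to p, because squaring permutes these roots. -/
theorem one_lt_lambdaOne {p : ℕ} (hp : Odd p) (hp3 : 3 ≤ p) : 1 < lambdaOne p := by
  by_contra! hle
  obtain ⟨n, rfl⟩ : ∃ n, p = n + 1 := ⟨p - 1, by omega⟩
  have hw := Complex.isPrimitiveRoot_exp (n + 1) n.succ_ne_zero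
  set w := Complex.exp (2 * Real.pi * Complex.I / (n + 1 : ℕ))
  have hprod : ∏ l ∈ range n, expSum (w ^ (l + 1)) (2 ^ orderTwo (n + 1)) =
      ((n : ℂ) + 1) ^ orderTwo (n + 1) := by
    simp only [expSum_two_pow]
    rw [prod_comm, prod_congr rfl (g := fun _ => (n : ℂ) + 1), prod_const, card_range]
    intro i _
    have hwi : IsPrimitiveRoot (w ^ 2 ^ i) (n + 1) :=
      hw.pow_of_coprime _ (Nat.Coprime.pow_left _ (Nat.coprime_two_left.2 hp))
    rw [← hwi.prod_one_sub_pow_eq_order]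
    exact prod_congr rfl fun l _ => by rw [← pow_mul, ← pow_mul, mul_comm]
  have h1 : ‖∏ l ∈ range n, expSum (w ^ (l + 1)) (2 ^ orderTwo (n + 1))‖ ≤ 1 := by
    rw [norm_prod]
    refine prod_le_one (fun _ _ => norm_nonneg _) fun l _ => ?_
    refine (norm_expSum_le_lambdaOne n.succ_pos ?_).trans hle
    rw [pow_right_comm, hw.pow_eq_one, one_pow]
  rw [hprod, norm_pow] at h1
  have h2 : (1 : ℝ) < ‖((n : ℂ) + 1)‖ := by
    have : ((n : ℂ) + 1) = ((n + 1 : ℕ) : ℂ) := by push_cast; rfl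
    rw [this, Complex.norm_natCast]
    exact_mod_cast (by omega : 1 < n + 1)
  exact absurd (one_lt_pow₀ h2 (orderTwo_pos hp).ne') h1.not_gt

theorem norm_one_sub_lt_two {p : ℕ} (hp : Odd p) {z : ℂ} (hz : z ^ p = 1) : ‖1 - z‖ < 2 := by
  have h1 : ‖z‖ = 1 := Complex.norm_eq_one_of_pow_eq_one hz hp.pos.ne'
  have h2 : 0 < ‖1 + z‖ := by
    refine norm_pos_iff.2 fun h => ?_
    have : z = -1 := by linear_combination h
    rw [this, hp.neg_one_pow] at hz
    norm_num at hz
  have h3 := parallelogram_law_with_norm ℝ (1 : ℂ) z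
  rw [h1, norm_one] at h3
  nlinarith [norm_nonneg (1 - z)]

/-- An eigenvalue is a product of s factors 1 - z^(2^i), each of modulus below 2 because -1 is not a
p-th root of unity for odd p. -/
theorem lambdaOne_lt {p : ℕ} (hp : Odd p) (hp3 : 3 ≤ p) : lambdaOne p < 2 ^ orderTwo p := by
  obtain ⟨z, hz, h⟩ := exists_norm_expSum_eq_lambdaOne hp.pos
  -- The strict comparison of products needs all factors to be nonzero; `one_lt_lambdaOne` provides
  -- this.
  have h0 : 0 < ‖expSum z (2 ^ orderTwo p)‖ := h ▸ one_pos.trans (one_lt_lambdaOne hp hp3)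
  rw [← h]
  rw [expSum_two_pow, norm_prod] at h0 ⊢
  have h1 : (2 : ℝ) ^ orderTwo p = ∏ _i ∈ range (orderTwo p), 2 := by simp
  rw [h1]
  refine prod_lt_prod_of_nonempty (fun i hi => ?_) (fun i _ => ?_)
    (nonempty_range_iff.2 (orderTwo_pos hp).ne')
  · refine (norm_nonneg _).lt_of_ne fun h' => h0.ne' (prod_eq_zero hi h'.symm)
  · refine norm_one_sub_lt_two hp ?_
    rw [pow_right_comm, hz, one_pow]

/-- The argument of `1 - z` is a rational multiple of `π` when `z` is a root of unity. -/
theorem one_sub_pow_eq_norm {p : ℕ} (hp : 0 < p) {z : ℂ} (hz : z ^ p = 1) :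
    (1 - z) ^ (4 * p) = (‖1 - z‖ : ℂ) ^ (4 * p) := by
  have h1 : ‖z‖ = 1 := Complex.norm_eq_one_of_pow_eq_one hz hp.ne'
  have h2 : (‖1 - z‖ : ℂ) ^ 2 = (1 - z) * (1 - (starRingEnd ℂ) z) := by
    rw [← Complex.mul_conj']; simp
  have h3 : z * (starRingEnd ℂ) z = 1 := by rw [Complex.mul_conj', h1]; simp
  have h4 : (‖1 - z‖ : ℂ) ^ 2 * (-z) = (1 - z) ^ 2 := by
    rw [h2]; linear_combination (1 - z) * h3
  have h5 : (-z) ^ (2 * p) = 1 := by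
    rw [pow_mul, neg_sq, pow_right_comm, hz, one_pow]
  calc (1 - z) ^ (4 * p) = ((1 - z) ^ 2) ^ (2 * p) := by rw [← pow_mul]; ring_nf
    _ = (‖1 - z‖ : ℂ) ^ (4 * p) := by rw [← h4, mul_pow, h5, mul_one, ← pow_mul]; ring_nf

/-- The set defining `rIndex` must be shown nonempty, since its infimum would otherwise be the
default value 0. -/
theorem rIndex_spec {p : ℕ} (hp : 0 < p) : 0 < rIndex p ∧
    ∀ z : ℂ, z ^ p = 1 → ‖expSum z (2 ^ orderTwo p)‖ = lambdaOne p →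
      expSum z (2 ^ orderTwo p) ^ rIndex p = (lambdaOne p : ℂ) ^ rIndex p := by
  have hne : {r : ℕ | 0 < r ∧ ∀ z ∈ spectrum ℂ (rarefactionMatrix p),
      ‖z‖ = lambdaOne p → z ^ r = (lambdaOne p : ℂ) ^ r}.Nonempty := by
    -- By `one_sub_pow_eq_norm`, 4p works for each factor 1 - z^(2^i), hence for their product.
    refine ⟨4 * p, by omega, fun μ hμ hn => ?_⟩
    obtain ⟨z, hz, rfl⟩ := (mem_spectrum_rarefactionMatrix hp _).1 hμ
    rw [← hn, expSum_two_pow, norm_prod, Complex.ofReal_prod, ← prod_pow, ← prod_pow]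
    refine prod_congr rfl fun i _ => one_sub_pow_eq_norm hp ?_
    rw [pow_right_comm, hz, one_pow]
  obtain ⟨h0, h⟩ := Nat.sInf_mem hne
  exact ⟨h0, fun z hz => h _ ((mem_spectrum_rarefactionMatrix hp _).2 ⟨z, hz, rfl⟩)⟩

theorem two_rpow_beta {p : ℕ} (hp : Odd p) (hp3 : 3 ≤ p) :
    ((2 : ℝ) ^ (orderTwo p : ℝ)) ^ beta p = lambdaOne p := by
  have h0 := one_pos.trans (one_lt_lambdaOne hp hp3)
  have hs : (orderTwo p : ℝ) ≠ 0 := by exact_mod_cast (orderTwo_pos hp).ne'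
  have h2 : Real.log 2 ≠ 0 := (Real.log_pos one_lt_two).ne'
  rw [← Real.rpow_mul zero_le_two, Real.rpow_def_of_pos two_pos, beta]
  rw [show Real.log 2 * ((orderTwo p : ℝ) * (Real.log (lambdaOne p) / (orderTwo p * Real.log 2))) =
    Real.log (lambdaOne p) by field_simp, Real.exp_log h0]

theorem beta_mem_Ioo {p : ℕ} (hp : Odd p) (hp3 : 3 ≤ p) : beta p ∈ Set.Ioo (0 : ℝ) 1 := by
  have h1 := one_lt_lambdaOne hp hp3
  have hs : (0 : ℝ) < orderTwo p := by exact_mod_cast orderTwo_pos hp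
  have h2 : 0 < Real.log 2 := Real.log_pos one_lt_two
  refine ⟨div_pos (Real.log_pos h1) (mul_pos hs h2), (div_lt_one (mul_pos hs h2)).2 ?_⟩
  rw [← Real.log_pow]
  exact Real.log_lt_log (one_pos.trans h1) (lambdaOne_lt hp hp3)

end

/-! ### Existence of ψ and the asymptotics of the rarefied sums -/

noncomputable section
open Finset Filter Topology

/-- A sequence that is multiplied by `μ` at each step, up to a bounded error, converges after
normalization by `Λ ^ m` if `μ` is either equal to `Λ` or of smaller modulus. The rate depends
only on the bounds. -/
theorem exists_limit_of_recursion (μ : ℂ) (Λ B : ℝ) (hΛ : 1 < Λ) (hB : 0 ≤ B)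
    (hμ : μ = Λ ∨ ‖μ‖ < Λ) :
    ∃ ε : ℕ → ℝ, Tendsto ε atTop (𝓝 0) ∧ ∀ y : ℕ → ℂ, ‖y 0‖ ≤ B →
      (∀ m, ‖y (m + 1) - μ * y m‖ ≤ B) → ∃ L : ℂ, ∀ m, ‖y m / (Λ : ℂ) ^ m - L‖ ≤ ε m := by
  have hΛ0 : 0 < Λ := one_pos.trans hΛ
  have hΛc : (Λ : ℂ) ≠ 0 := by exact_mod_cast hΛ0.ne'
  rcases hμ with rfl | hμ
  · have hr : Λ⁻¹ < 1 := inv_lt_one_of_one_lt₀ hΛ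
    refine ⟨fun m => B / Λ * Λ⁻¹ ^ m / (1 - Λ⁻¹), ?_, fun y _ hy => ?_⟩
    · have := ((tendsto_pow_atTop_nhds_zero_of_lt_one (inv_nonneg.2 hΛ0.le) hr).const_mul
        (B / Λ)).div_const (1 - Λ⁻¹)
      simpa using this
    · have hd : ∀ m, dist (y m / (Λ : ℂ) ^ m) (y (m + 1) / (Λ : ℂ) ^ (m + 1)) ≤
          B / Λ * Λ⁻¹ ^ m := by
        intro m
        have h1 : y m / (Λ : ℂ) ^ m - y (m + 1) / (Λ : ℂ) ^ (m + 1) =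
            -((y (m + 1) - Λ * y m) / (Λ : ℂ) ^ (m + 1)) := by
          field_simp; ring
        rw [dist_eq_norm, h1, norm_neg, norm_div, norm_pow, Complex.norm_real,
          Real.norm_of_nonneg hΛ0.le]
        calc _ ≤ B / Λ ^ (m + 1) := by gcongr; exact hy m
          _ = _ := by rw [inv_pow, pow_succ]; field_simp
      obtain ⟨L, hL⟩ := cauchySeq_tendsto_of_complete (cauchySeq_of_le_geometric _ _ hr hd)
      exact ⟨L, fun m => by
        rw [← dist_eq_norm]
        exact dist_le_of_le_geometric_of_tendsto _ _ hr hd hL m⟩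
  · obtain ⟨θ, hθ, hθΛ⟩ := exists_between (max_lt hμ hΛ)
    obtain ⟨hθμ, hθ1⟩ := max_lt_iff.1 hθ
    have hpos : 0 < θ - ‖μ‖ := sub_pos.2 hθμ
    have hθ0 : 0 < θ := one_pos.trans hθ1
    refine ⟨fun m => (B / (θ - ‖μ‖) + B) * (θ / Λ) ^ m, ?_, fun y hy0 hy => ⟨0, fun m => ?_⟩⟩
    · have := (tendsto_pow_atTop_nhds_zero_of_lt_one (div_nonneg hθ0.le hΛ0.le)
        ((div_lt_one hΛ0).2 hθΛ)).const_mul (B / (θ - ‖μ‖) + B)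
      simpa using this
    · have hb : ∀ m, ‖y m‖ ≤ (B / (θ - ‖μ‖) + B) * θ ^ m := by
        intro m
        induction m with
        | zero =>
          have : 0 ≤ B / (θ - ‖μ‖) := by positivity
          simp only [pow_zero, mul_one]; linarith
        | succ m ih =>
          have h1 : ‖y (m + 1)‖ ≤ B + ‖μ‖ * ‖y m‖ := by
            calc ‖y (m + 1)‖ = ‖(y (m + 1) - μ * y m) + μ * y m‖ := by rw [sub_add_cancel]
              _ ≤ _ := (norm_add_le _ _).trans (by rw [norm_mul]; gcongr; exact hy m)
          have h2 : B ≤ (B / (θ - ‖μ‖) + B) * (θ - ‖μ‖) * θ ^ m := by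
            have h3 : (B / (θ - ‖μ‖) + B) * (θ - ‖μ‖) = B + B * (θ - ‖μ‖) := by field_simp
            have h4 : 1 ≤ θ ^ m := one_le_pow₀ hθ1.le
            rw [h3]
            have h5 : 0 ≤ B * (θ - ‖μ‖) := by positivity
            nlinarith
          have h3 := mul_le_mul_of_nonneg_left ih (norm_nonneg μ)
          rw [pow_succ]
          linarith
      beta_reduce
      rw [sub_zero, norm_div, norm_pow, Complex.norm_real, Real.norm_of_nonneg hΛ0.le, div_pow,
        ← mul_div_assoc]
      gcongr
      exact hb m

/-- The rarefied sums are recovered from the exponential sums by finite Fourier inversion. -/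
theorem natCast_mul_rarefiedSum {p : ℕ} {w : ℂ} (hp : 0 < p) (hw : IsPrimitiveRoot w p)
    (j n : ℕ) :
    (p : ℂ) * (rarefiedSum p j n : ℂ) =
      ∑ l ∈ range p, ((w ^ l)⁻¹) ^ j * expSum (w ^ l) n := by
  have hw0 : w ≠ 0 := hw.ne_zero hp.ne'
  unfold rarefiedSum expSum
  simp only [Int.cast_sum, sum_filter, mul_sum]
  rw [sum_comm]
  refine sum_congr rfl fun m _ => ?_
  set u : ℂ := w ^ ((m : ℤ) - j) with hu
  have h1 : ∑ l ∈ range p, ((w ^ l)⁻¹) ^ j * ((eta m : ℂ) * (w ^ l) ^ m) =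
      (eta m : ℂ) * ∑ l ∈ range p, u ^ l := by
    rw [mul_sum]
    refine sum_congr rfl fun l _ => ?_
    rw [hu, zpow_sub₀ hw0, zpow_natCast, zpow_natCast, div_pow, pow_right_comm w m,
      pow_right_comm w j, inv_pow]
    ring
  rw [h1]
  by_cases h : (m : ℤ) ≡ j [ZMOD p]
  · have hu1 : u = 1 := (hw.zpow_eq_one_iff_dvd _).2 (Int.modEq_iff_dvd.1 h.symm)
    simp [h, hu1, mul_comm]
  · have hu1 : u ≠ 1 := fun h' => h (Int.modEq_iff_dvd.2 ((hw.zpow_eq_one_iff_dvd _).1 h')).symm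
    have hup : u ^ p = 1 := by
      rw [hu, ← zpow_natCast, zpow_comm, zpow_natCast, hw.pow_eq_one, one_zpow]
    have h2 := geom_sum_mul u p
    rw [hup, sub_self, mul_eq_zero] at h2
    simp [h, h2.resolve_right (sub_ne_zero.2 hu1)]

theorem exists_floor_mul_eq (R : ℕ) {Y : ℝ} (hY : 0 ≤ Y) :
    ∃ c ≤ R, ⌊(R : ℝ) * Y⌋₊ = R * ⌊Y⌋₊ + c := by
  have h1 : R * ⌊Y⌋₊ ≤ ⌊(R : ℝ) * Y⌋₊ := by
    refine Nat.le_floor ?_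
    push_cast
    gcongr
    exact Nat.floor_le hY
  have h2 : ⌊(R : ℝ) * Y⌋₊ ≤ R * ⌊Y⌋₊ + R := by
    refine Nat.floor_le_of_le ?_
    push_cast
    nlinarith [(Nat.lt_floor_add_one Y).le, (Nat.cast_nonneg R : (0 : ℝ) ≤ R)]
  exact ⟨⌊(R : ℝ) * Y⌋₊ - R * ⌊Y⌋₊, by omega, by omega⟩

/-- Each exponential sum along ⌊2^(srm) X⌋ satisfies the approximate recursion with multiplier
E_z(2^s)^r. The definition of r gives exactly the dichotomy required by `exists_limit_of_recursion`,
whose rate does not depend on X. -/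
theorem exists_rarefiedSum_limit {p : ℕ} (hp : Odd p) (hp3 : 3 ≤ p) (j : ℕ) :
    ∃ ε : ℕ → ℝ, Tendsto ε atTop (𝓝 0) ∧ ∀ X : ℝ, 1 ≤ X →
      X ≤ (2 : ℝ) ^ (orderTwo p * rIndex p) → ∃ L : ℝ, ∀ m : ℕ,
        |(rarefiedSum p j ⌊((2 : ℝ) ^ (orderTwo p * rIndex p)) ^ m * X⌋₊ : ℝ) /
          (lambdaOne p ^ rIndex p) ^ m - L| ≤ ε m := by
  obtain ⟨hr0, hr⟩ := rIndex_spec hp.pos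
  set r := rIndex p
  set s := orderTwo p
  have hw := Complex.isPrimitiveRoot_exp p hp.pos.ne'
  set w := Complex.exp (2 * Real.pi * Complex.I / p)
  have h1 := one_lt_lambdaOne hp hp3
  have hwl : ∀ l : ℕ, (w ^ l) ^ p = 1 := fun l => by rw [pow_right_comm, hw.pow_eq_one, one_pow]
  have key : ∀ l : ℕ, ∃ ε : ℕ → ℝ, Tendsto ε atTop (𝓝 0) ∧ ∀ y : ℕ → ℂ,
      ‖y 0‖ ≤ (2 : ℝ) ^ (s * r) →
      (∀ m, ‖y (m + 1) - expSum (w ^ l) (2 ^ s) ^ r * y m‖ ≤ (2 : ℝ) ^ (s * r)) →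
      ∃ L : ℂ, ∀ m, ‖y m / ((lambdaOne p ^ r : ℝ) : ℂ) ^ m - L‖ ≤ ε m := by
    intro l
    refine exists_limit_of_recursion _ _ _ (one_lt_pow₀ h1 hr0.ne') (by positivity) ?_
    rcases (norm_expSum_le_lambdaOne hp.pos (hwl l)).eq_or_lt with h | h
    · left
      rw [hr _ (hwl l) h]
      push_cast
      rfl
    · right
      rw [norm_pow]
      exact pow_lt_pow_left₀ h (norm_nonneg _) hr0.ne'
  choose ε hε hlim using key
  refine ⟨fun m => ∑ l ∈ range p, ε l m, ?_, fun X hX1 hXR => ?_⟩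
  · simpa using tendsto_finsetSum (range p) fun l _ => hε l
  have hX0 : 0 ≤ X := zero_le_one.trans hX1
  have hL : ∀ l : ℕ, ∃ L : ℂ, ∀ m, ‖expSum (w ^ l) ⌊((2 : ℝ) ^ (s * r)) ^ m * X⌋₊ /
      ((lambdaOne p ^ r : ℝ) : ℂ) ^ m - L‖ ≤ ε l m := by
    intro l
    refine hlim l (fun m => expSum (w ^ l) ⌊((2 : ℝ) ^ (s * r)) ^ m * X⌋₊) ?_ fun m => ?_
    · have hn : ‖w ^ l‖ = 1 := Complex.norm_eq_one_of_pow_eq_one (hwl l) hp.pos.ne'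
      refine (norm_expSum_le hn _).trans ?_
      rw [pow_zero, one_mul]
      exact (Nat.floor_le hX0).trans hXR
    · obtain ⟨c, hc, h⟩ := exists_floor_mul_eq (2 ^ (s * r))
        (Y := ((2 : ℝ) ^ (s * r)) ^ m * X) (by positivity)
      push_cast at h
      rw [pow_succ', mul_assoc, h]
      exact norm_expSum_sub_le hp.pos.ne' (hwl l) r _ c hc
  choose L hL using hL
  -- The inversion formula passes to the limit; taking real parts is harmless because the rarefied
  -- sums are real.
  refine ⟨((∑ l ∈ range p, ((w ^ l)⁻¹) ^ j * L l) / p).re, fun m => ?_⟩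
  set n := ⌊((2 : ℝ) ^ (s * r)) ^ m * X⌋₊
  set D := (lambdaOne p ^ r) ^ m
  have hpc : (p : ℂ) ≠ 0 := by exact_mod_cast hp.pos.ne'
  have hS : (((rarefiedSum p j n : ℝ) / D : ℝ) : ℂ) =
      (∑ l ∈ range p, ((w ^ l)⁻¹) ^ j * (expSum (w ^ l) n / (D : ℂ))) / p := by
    rw [eq_div_iff hpc]
    push_cast
    simp only [← mul_div_assoc, ← sum_div]
    rw [← natCast_mul_rarefiedSum hp.pos hw]
    ring
  rw [← Complex.ofReal_re ((rarefiedSum p j n : ℝ) / D), ← Complex.sub_re, hS]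
  refine (Complex.abs_re_le_norm _).trans ?_
  rw [← sub_div, ← sum_sub_distrib, norm_div, Complex.norm_natCast]
  refine (div_le_self (norm_nonneg _) (by exact_mod_cast hp.pos)).trans ?_
  refine (norm_sum_le _ _).trans (sum_le_sum fun l _ => ?_)
  have hn : ‖w ^ l‖ = 1 := Complex.norm_eq_one_of_pow_eq_one (hwl l) hp.pos.ne'
  rw [← mul_sub, norm_mul, norm_pow, norm_inv, hn, inv_one, one_pow, one_mul]
  have := hL l m
  rwa [← Complex.ofReal_pow] at this

theorem two_rpow_eq {p : ℕ} (x : ℝ) (m : ℕ) :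
    (2 : ℝ) ^ ((rIndex p : ℝ) * (orderTwo p : ℝ) * (x + (m : ℝ))) =
      ((2 : ℝ) ^ (orderTwo p * rIndex p)) ^ m * (2 : ℝ) ^ ((rIndex p : ℝ) * orderTwo p * x) := by
  rw [mul_add, Real.rpow_add two_pos, mul_comm, ← pow_mul, ← Real.rpow_natCast]
  push_cast
  ring_nf

theorem two_pow_mul_rpow_beta {p : ℕ} (hp : Odd p) (hp3 : 3 ≤ p) {X : ℝ} (hX : 0 ≤ X) (m : ℕ) :
    (((2 : ℝ) ^ (orderTwo p * rIndex p)) ^ m * X) ^ beta p =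
      (lambdaOne p ^ rIndex p) ^ m * X ^ beta p := by
  rw [Real.mul_rpow (by positivity) hX, ← two_rpow_beta hp hp3, Real.rpow_pow_comm (by positivity),
    Real.rpow_pow_comm (by positivity), Real.rpow_natCast, pow_mul]

/-- The limit defining `psi` exists, uniformly on `[0, 1]`. -/
theorem exists_rarefiedSum_sub_psi_le {p : ℕ} (hp : Odd p) (hp3 : 3 ≤ p) (j : ℕ) :
    ∃ ε : ℕ → ℝ, Tendsto ε atTop (𝓝 0) ∧ ∀ x ∈ Set.Icc (0 : ℝ) 1, ∀ m : ℕ,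
      |(rarefiedSum p j ⌊(2 : ℝ) ^ ((rIndex p : ℝ) * (orderTwo p : ℝ) * (x + (m : ℝ)))⌋₊ : ℝ) /
        ((2 : ℝ) ^ ((rIndex p : ℝ) * (orderTwo p : ℝ) * (x + (m : ℝ)))) ^ beta p - psi p j x| ≤
        ε m := by
  obtain ⟨ε, hε, h⟩ := exists_rarefiedSum_limit hp hp3 j
  refine ⟨ε, hε, fun x hx m => ?_⟩
  set X : ℝ := (2 : ℝ) ^ ((rIndex p : ℝ) * orderTwo p * x) with hX
  have hX1 : 1 ≤ X := Real.one_le_rpow one_le_two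
    (mul_nonneg (by positivity) hx.1)
  have hXR : X ≤ (2 : ℝ) ^ (orderTwo p * rIndex p) := by
    rw [← Real.rpow_natCast]
    refine Real.rpow_le_rpow_of_exponent_le one_le_two ?_
    push_cast
    rw [mul_comm (orderTwo p : ℝ)]
    exact mul_le_of_le_one_right (by positivity) hx.2
  -- Because X^β ≥ 1, dividing by it does not enlarge the error.
  have hXβ : 1 ≤ X ^ beta p := Real.one_le_rpow hX1 (beta_mem_Ioo hp hp3).1.le
  obtain ⟨L, hL⟩ := h X hX1 hXR
  have hb : ∀ m : ℕ, |(rarefiedSum p j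
      ⌊(2 : ℝ) ^ ((rIndex p : ℝ) * (orderTwo p : ℝ) * (x + (m : ℝ)))⌋₊ : ℝ) /
        ((2 : ℝ) ^ ((rIndex p : ℝ) * (orderTwo p : ℝ) * (x + (m : ℝ)))) ^ beta p -
        L / X ^ beta p| ≤ ε m := by
    intro m
    rw [two_rpow_eq, two_pow_mul_rpow_beta hp hp3 (zero_le_one.trans hX1), ← div_div, ← sub_div,
      abs_div, abs_of_pos (one_pos.trans_le hXβ)]
    exact (div_le_self (abs_nonneg _) hXβ).trans (hL m)
  have hlim : psi p j x = L / X ^ beta p := by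
    refine Tendsto.limUnder_eq ?_
    rw [tendsto_iff_norm_sub_tendsto_zero]
    exact squeeze_zero (fun _ => norm_nonneg _) hb hε
  rw [hlim]
  exact hb m

theorem abs_rarefiedSum_le (p : ℕ) (j : ℤ) (n : ℕ) : |(rarefiedSum p j n : ℝ)| ≤ n := by
  unfold rarefiedSum
  rw [Int.cast_sum]
  refine (abs_sum_le_sum_abs _ _).trans ?_
  have : ∀ i : ℕ, |((eta i : ℤ) : ℝ)| = 1 := fun i => by
    rcases eta_eq_one_or i with h | h <;> simp [h]
  simp only [this, sum_const, nsmul_eq_mul, mul_one]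
  exact_mod_cast (card_filter_le _ _).trans (card_range n).le

/-- Boundedness makes the infimum and supremum in the rarefaction domain genuine bounds rather than
default values. The term m = 0 of the uniform approximation suffices. -/
theorem exists_abs_psi_le {p : ℕ} (hp : Odd p) (hp3 : 3 ≤ p) (j : ℕ) :
    ∃ B : ℝ, ∀ x ∈ Set.Icc (0 : ℝ) 1, |psi p j x| ≤ B := by
  obtain ⟨ε, -, h⟩ := exists_rarefiedSum_sub_psi_le hp hp3 j
  refine ⟨(2 : ℝ) ^ ((rIndex p : ℝ) * (orderTwo p : ℝ)) + ε 0, fun x hx => ?_⟩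
  have h0 := h x hx 0
  simp only [Nat.cast_zero, add_zero] at h0
  set X : ℝ := (2 : ℝ) ^ ((rIndex p : ℝ) * orderTwo p * x) with hX
  have hX1 : 1 ≤ X := Real.one_le_rpow one_le_two
    (mul_nonneg (by positivity) hx.1)
  have hXR : X ≤ (2 : ℝ) ^ ((rIndex p : ℝ) * orderTwo p) :=
    Real.rpow_le_rpow_of_exponent_le one_le_two (mul_le_of_le_one_right (by positivity) hx.2)
  have hXβ : 1 ≤ X ^ beta p := Real.one_le_rpow hX1 (beta_mem_Ioo hp hp3).1.le
  have h1 : |(rarefiedSum p j ⌊X⌋₊ : ℝ) / X ^ beta p| ≤ X := by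
    rw [abs_div, abs_of_pos (one_pos.trans_le hXβ)]
    exact (div_le_self (abs_nonneg _) hXβ).trans
      ((abs_rarefiedSum_le _ _ _).trans (Nat.floor_le (zero_le_one.trans hX1)))
  rw [abs_le] at *
  constructor <;> linarith

/-- The asymptotics `S_{p,j}(n) = n^β ψ_{p,j}(log n / (r s log 2)) + o(n^β)`. -/
theorem eventually_rarefiedSum_sub_psi_le {p : ℕ} (hp : Odd p) (hp3 : 3 ≤ p) (j : ℕ) {δ : ℝ}
    (hδ : 0 < δ) : ∀ᶠ n : ℕ in atTop, ∃ x ∈ Set.Icc (0 : ℝ) 1,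
      |(rarefiedSum p j n : ℝ) / (n : ℝ) ^ beta p - psi p j x| ≤ δ := by
  obtain ⟨ε, hε, h⟩ := exists_rarefiedSum_sub_psi_le hp hp3 j
  have hrs : 0 < (rIndex p : ℝ) * orderTwo p := by
    have h1 : (0 : ℝ) < rIndex p := by exact_mod_cast (rIndex_spec hp.pos).1
    have h2 : (0 : ℝ) < orderTwo p := by exact_mod_cast orderTwo_pos hp
    positivity
  have hl2 : 0 < Real.log 2 := Real.log_pos one_lt_two
  have hy : Tendsto (fun n : ℕ => Real.log n / ((rIndex p : ℝ) * orderTwo p * Real.log 2))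
      atTop atTop :=
    (Real.tendsto_log_atTop.comp tendsto_natCast_atTop_atTop).atTop_div_const (by positivity)
  have hm := (tendsto_nat_floor_atTop (α := ℝ)).comp hy
  filter_upwards [hm.eventually (hε.eventually (gt_mem_nhds hδ)), eventually_ge_atTop 1]
    with n hn hn1
  have hn1' : (1 : ℝ) ≤ n := by exact_mod_cast hn1
  -- The integer part of y serves as m and its fractional part as x. As x varies with n, uniformity
  -- of the convergence is essential.
  set y := Real.log n / ((rIndex p : ℝ) * orderTwo p * Real.log 2) with hydef
  have hy0 : 0 ≤ y := div_nonneg (Real.log_nonneg hn1') (by positivity)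
  have h2y : (2 : ℝ) ^ ((rIndex p : ℝ) * (orderTwo p : ℝ) * (y - ⌊y⌋₊ + (⌊y⌋₊ : ℝ))) = n := by
    have hc : ∀ c L : ℝ, 0 < c → Real.log 2 * (c * (L / (c * Real.log 2))) = L :=
      fun c L hc => by field_simp
    rw [sub_add_cancel, Real.rpow_def_of_pos two_pos, hydef, hc _ _ hrs]
    exact Real.exp_log (by linarith)
  have hx : y - ⌊y⌋₊ ∈ Set.Icc (0 : ℝ) 1 :=
    ⟨sub_nonneg.2 (Nat.floor_le hy0), by linarith [Nat.lt_floor_add_one y]⟩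
  refine ⟨_, hx, ?_⟩
  have := h _ hx ⌊y⌋₊
  rw [h2y, Nat.floor_natCast] at this
  exact this.trans hn.le

end

/-! ### The rarefaction domain and the exact order of the exponential sum -/

noncomputable section
open Finset Filter Topology

theorem isCompact_rarefactionDomain (p : ℕ) (t : ℤ) : IsCompact (rarefactionDomain p t) := by
  have hK : IsCompact (Set.univ.pi fun j : Fin p =>
      Set.Icc (sInf (psi p j '' Set.Icc 0 1)) (sSup (psi p j '' Set.Icc 0 1))) :=
    isCompact_univ_pi fun _ => isCompact_Icc
  have hf : Continuous fun y : Fin p → ℝ => ∑ j : Fin p, (y j : ℂ) *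
      Complex.exp (-(2 * (Real.pi : ℂ) * Complex.I * (t : ℂ) / (p : ℂ))) ^ (j : ℕ) := by
    fun_prop
  convert hK.image hf using 1
  ext z
  simp only [rarefactionDomain, Set.mem_ofPred_eq, Set.mem_image, Set.mem_univ_pi, eq_comm]

/-- The `p`-th root of unity `e^{-2πi t/p}`. -/
def xi (p : ℕ) (t : ℤ) : ℂ := Complex.exp (-(2 * (Real.pi : ℂ) * Complex.I * (t : ℂ) / (p : ℂ)))

theorem xi_pow {p : ℕ} (hp : 0 < p) (t : ℤ) : xi p t ^ p = 1 := by
  have hpc : (p : ℂ) ≠ 0 := by exact_mod_cast hp.ne'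
  rw [xi, ← Complex.exp_nat_mul, Complex.exp_eq_one_iff]
  exact ⟨-t, by push_cast; field_simp⟩

theorem norm_xi {p : ℕ} (hp : 0 < p) (t : ℤ) : ‖xi p t‖ = 1 :=
  Complex.norm_eq_one_of_pow_eq_one (xi_pow hp t) hp.ne'

theorem xi_sq_ne_one {p : ℕ} (hp : Odd p) (hp3 : 3 ≤ p) {t : ℤ} (htp : IsCoprime t (p : ℤ)) :
    xi p t ^ 2 ≠ 1 := by
  intro h2
  have h1 : xi p t = 1 := by
    obtain ⟨q, hq⟩ := hp
    have h := xi_pow (by omega : 0 < p) t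
    nth_rewrite 2 [hq] at h
    rwa [pow_succ, pow_mul, h2, one_pow, one_mul] at h
  rw [xi, Complex.exp_eq_one_iff] at h1
  obtain ⟨n, hn⟩ := h1
  have hpc : (p : ℂ) ≠ 0 := by exact_mod_cast hp.pos.ne'
  have h3 : (t : ℂ) = -n * p := by
    field_simp at hn
    linear_combination -hn
  have h4 : t = -n * p := by exact_mod_cast h3
  have h5 : (p : ℤ) ∣ t := ⟨-n, by rw [h4]; ring⟩
  have h6 : IsUnit (p : ℤ) := htp.isUnit_of_dvd' h5 dvd_rfl
  rw [Int.isUnit_iff] at h6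
  omega

/-- If `0` is not in the rarefaction domain, the exponential sum at `ξ` has exact order `n^β`. -/
theorem exists_norm_expSum_xi_bounds {p : ℕ} (hp : Odd p) (hp3 : 3 ≤ p) {t : ℤ}
    (hR : (0 : ℂ) ∉ rarefactionDomain p t) :
    ∃ c C : ℝ, 0 < c ∧ ∀ᶠ n : ℕ in atTop, c * (n : ℝ) ^ beta p ≤ ‖expSum (xi p t) n‖ ∧
      ‖expSum (xi p t) n‖ ≤ C * (n : ℝ) ^ beta p := by
  have hcomp := isCompact_rarefactionDomain p t
  obtain ⟨δ, hδ, hball⟩ := Metric.isOpen_iff.1 hcomp.isClosed.isOpen_compl 0 hR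
  obtain ⟨C, hC⟩ := hcomp.isBounded.exists_norm_le
  have hp0 : (0 : ℝ) < p := by exact_mod_cast hp.pos
  have hεpos : 0 < δ / (2 * p) := by positivity
  refine ⟨δ / 2, C + δ / 2, by positivity, ?_⟩
  -- The point x may depend on j, which is harmless since the coordinates y_j vary independently in
  -- R(k). The p errors δ/(2p) add up to half the distance from 0 to R(k).
  have hev : ∀ᶠ n : ℕ in atTop, ∀ j : Fin p, ∃ x ∈ Set.Icc (0 : ℝ) 1,
      |(rarefiedSum p (j : ℕ) n : ℝ) / (n : ℝ) ^ beta p - psi p j x| ≤ δ / (2 * p) :=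
    eventually_all.2 fun j => eventually_rarefiedSum_sub_psi_le hp hp3 j hεpos
  filter_upwards [hev, eventually_ge_atTop 1] with n hn hn1
  choose x hx hS using hn
  have hn0 : (0 : ℝ) < n := by exact_mod_cast hn1
  have hnβ : 0 < (n : ℝ) ^ beta p := Real.rpow_pos_of_pos hn0 _
  set z : ℂ := ∑ j : Fin p, (psi p j (x j) : ℂ) * xi p t ^ (j : ℕ) with hz
  have hzR : z ∈ rarefactionDomain p t := by
    refine ⟨fun j => psi p j (x j), fun j => ?_, rfl⟩
    obtain ⟨B, hB⟩ := exists_abs_psi_le hp hp3 j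
    have hmem : psi p j (x j) ∈ psi p j '' Set.Icc 0 1 := ⟨_, hx j, rfl⟩
    constructor
    · refine csInf_le ⟨-B, ?_⟩ hmem
      rintro _ ⟨u, hu, rfl⟩
      exact (abs_le.1 (hB u hu)).1
    · refine le_csSup ⟨B, ?_⟩ hmem
      rintro _ ⟨u, hu, rfl⟩
      exact (abs_le.1 (hB u hu)).2
  have hzδ : δ ≤ ‖z‖ := by
    by_contra! h
    exact hball (by simpa using h) hzR
  have hsum : expSum (xi p t) n / ((n : ℝ) ^ beta p : ℝ) =
      ∑ j : Fin p, (((rarefiedSum p (j : ℕ) n : ℝ) / (n : ℝ) ^ beta p : ℝ) : ℂ) *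
        xi p t ^ (j : ℕ) := by
    have h := sum_rarefiedSum_sub_mul_pow hp.pos (xi_pow hp.pos t) 0 n
    rw [pow_zero, one_mul] at h
    rw [← h, sum_div]
    refine sum_congr rfl fun j _ => ?_
    push_cast
    rw [sub_zero]
    ring
  have hdiff : ‖expSum (xi p t) n / ((n : ℝ) ^ beta p : ℝ) - z‖ ≤ δ / 2 := by
    rw [hsum, hz, ← sum_sub_distrib]
    calc _ ≤ ∑ j : Fin p, δ / (2 * p) := by
          refine norm_sum_le_of_le _ fun j _ => ?_
          rw [← sub_mul, norm_mul, norm_pow, norm_xi hp.pos, one_pow, mul_one,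
            ← Complex.ofReal_sub, Complex.norm_real]
          exact hS j
      _ = δ / 2 := by
          rw [sum_const, card_univ, Fintype.card_fin, nsmul_eq_mul]
          field_simp
  have hnorm : ‖expSum (xi p t) n / ((n : ℝ) ^ beta p : ℝ)‖ =
      ‖expSum (xi p t) n‖ / (n : ℝ) ^ beta p := by
    rw [norm_div, Complex.norm_real, Real.norm_of_nonneg hnβ.le]
  have htri := norm_sub_norm_le z (expSum (xi p t) n / ((n : ℝ) ^ beta p : ℝ))
  have htri' := norm_sub_norm_le (expSum (xi p t) n / ((n : ℝ) ^ beta p : ℝ)) z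
  rw [norm_sub_rev] at htri
  rw [hnorm] at htri htri'
  have hzC := hC z hzR
  constructor
  · rw [← le_div_iff₀ hnβ]; linarith
  · rw [← div_le_iff₀ hnβ]; linarith

/-! ### From the exponential sum to the structure factor -/

/-- If k(a-b)/2 = qπ, the integrand is the character of frequency -(2q + m), which is odd, hence
nonzero, so its integral over a period is 0. -/
theorem fourierCoefficient_eq_zero {a b k : ℝ} (h : Real.sin (k * (a - b) / 2) = 0) {m : ℤ}
    (hm : Odd m) : fourierCoefficient a b m k = 0 := by
  obtain ⟨q, hq⟩ := Real.sin_eq_zero_iff.1 h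
  have hk : (k : ℂ) * ((2 * (a - b) : ℝ) : ℂ) = 4 * q * Real.pi := by
    have : k * (2 * (a - b)) = 4 * q * Real.pi := by linarith
    exact_mod_cast this
  have hne : ((2 * q + m : ℤ) : ℂ) ≠ 0 := by
    obtain ⟨d, hd⟩ := hm
    exact_mod_cast (by omega : 2 * q + m ≠ 0)
  have hpt : ∀ x : ℝ,
      Complex.exp (-(Complex.I * (k : ℂ) * ((2 * (a - b) : ℝ) : ℂ) * ((Int.fract x : ℝ) : ℂ))) *
        Complex.exp (-(2 * (Real.pi : ℂ) * Complex.I * (m : ℂ) * (x : ℂ))) =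
      Complex.exp (-(2 * Real.pi * Complex.I * ((2 * q + m : ℤ) : ℂ)) * x) := by
    intro x
    rw [← Complex.exp_add, Complex.exp_eq_exp_iff_exists_int]
    refine ⟨2 * q * ⌊x⌋, ?_⟩
    rw [mul_assoc Complex.I, hk, Int.fract]
    push_cast
    ring
  have hc : -(2 * Real.pi * Complex.I * ((2 * q + m : ℤ) : ℂ)) ≠ 0 :=
    neg_ne_zero.2 (mul_ne_zero Complex.two_pi_I_ne_zero hne)
  unfold fourierCoefficient
  simp only [hpt]
  rw [integral_exp_mul_complex hc, div_eq_zero_iff]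
  left
  rw [sub_eq_zero, Complex.exp_eq_exp_iff_exists_int]
  exact ⟨-(2 * q + m), by push_cast; ring⟩

theorem sin_ne_zero_of_kappaEta_ne_zero {a b k : ℝ} (h : kappaEta a b k ≠ 0) :
    Real.sin (k * (a - b) / 2) ≠ 0 := by
  intro hs
  apply h
  refine Tendsto.limUnder_eq (tendsto_const_nhds.congr fun N => ?_)
  exact (sum_eq_zero fun m hm => fourierCoefficient_eq_zero hs (mem_filter.1 hm).2).symm

theorem f_natCast (a b : ℝ) (n : ℕ) :
    f a b n = ∑ m ∈ range n, ((a + b) / 2 + (a - b) / 2 * (eta m : ℝ)) := by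
  unfold f
  rcases Nat.eq_zero_or_pos n with rfl | hn
  · simp
  · rw [Int.sign_eq_one_of_pos (by exact_mod_cast hn)]
    simp

theorem f_natCast_succ (a b : ℝ) (n : ℕ) :
    f a b (n + 1 : ℕ) = f a b n + ((a + b) / 2 + (a - b) / 2 * (eta n : ℝ)) := by
  rw [f_natCast, f_natCast, sum_range_succ]

/-- The steps with indices 2m and 2m+1 have opposite signs η, so each pair has total length a + b.
-/
theorem f_two_mul (a b : ℝ) (m : ℕ) : f a b (2 * m : ℕ) = (a + b) * m := by
  induction m with
  | zero => simp [f]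
  | succ m ih =>
    rw [show 2 * (m + 1) = 2 * m + 1 + 1 by ring, f_natCast_succ, f_natCast_succ, ih, eta_two_mul,
      eta_two_mul_add_one]
    push_cast
    ring

theorem exp_f_two_mul {a b k : ℝ} (hab : a + b ≠ 0) {t : ℤ} {p : ℕ}
    (hk : k = 4 * Real.pi / (a + b) * ((t : ℝ) / (p : ℝ))) (m : ℕ) :
    Complex.exp (-(Complex.I * (k : ℂ) * (f a b (2 * m : ℕ) : ℂ))) = (xi p t ^ 2) ^ m := by
  rw [← pow_mul, xi, ← Complex.exp_nat_mul]
  congr 1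
  have : k * f a b (2 * m : ℕ) = 4 * Real.pi * (t / p) * m := by
    rw [f_two_mul, hk]; field_simp
  have h : (k : ℂ) * (f a b (2 * m : ℕ) : ℂ) = 4 * Real.pi * (t / p) * m := by exact_mod_cast this
  rw [mul_assoc, h]
  push_cast
  ring

theorem exp_f_two_mul_add_one {a b k : ℝ} (hab : a + b ≠ 0) {t : ℤ} {p : ℕ}
    (hk : k = 4 * Real.pi / (a + b) * ((t : ℝ) / (p : ℝ))) (m : ℕ) :
    Complex.exp (-(Complex.I * (k : ℂ) * (f a b (2 * m + 1 : ℕ) : ℂ))) =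
      (xi p t ^ 2) ^ m * xi p t * (Real.cos (k * (a - b) / 2) -
        Complex.I * eta m * Real.sin (k * (a - b) / 2)) := by
  have h1 : (Real.cos (k * (a - b) / 2) - Complex.I * eta m * Real.sin (k * (a - b) / 2) : ℂ) =
      Complex.exp (-(eta m * (k * (a - b) / 2 : ℝ) * Complex.I)) := by
    rcases eta_eq_one_or m with h | h
    · rw [h, ← neg_mul, Complex.exp_mul_I]
      push_cast
      rw [one_mul, Complex.cos_neg, Complex.sin_neg]
      ring
    · rw [h, ← neg_mul, Complex.exp_mul_I]
      push_cast
      rw [neg_one_mul, neg_neg]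
      ring
  rw [h1, ← exp_f_two_mul hab hk, xi, ← Complex.exp_add, ← Complex.exp_add]
  congr 1
  have h2 : k * f a b (2 * m + 1 : ℕ) = k * f a b (2 * m : ℕ) + 2 * Real.pi * (t / p) +
      eta m * (k * (a - b) / 2) := by
    rw [f_natCast_succ, eta_two_mul]
    have : k * ((a + b) / 2) = 2 * Real.pi * (t / p) := by rw [hk]; field_simp; ring
    linear_combination this
  have h3 : (k : ℂ) * f a b (2 * m + 1 : ℕ) = k * f a b (2 * m : ℕ) + 2 * Real.pi * (t / p) +
      eta m * (k * (a - b) / 2 : ℝ) := by exact_mod_cast h2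
  rw [mul_assoc, h3]
  ring

theorem norm_exp_neg_I_mul (x y : ℝ) : ‖Complex.exp (-(Complex.I * (x : ℂ) * (y : ℂ)))‖ = 1 := by
  have : -(Complex.I * (x : ℂ) * (y : ℂ)) = ((-(x * y) : ℝ) : ℂ) * Complex.I := by
    push_cast; ring
  rw [this, Complex.norm_exp_ofReal_mul_I]

/-- Up to a bounded error, the structure factor is a multiple of the Thue-Morse exponential sum. -/
theorem exists_norm_sum_exp_sub_le {a b k : ℝ} (hab : a + b ≠ 0) {t : ℤ} {p : ℕ} (hp : Odd p)
    (hp3 : 3 ≤ p) (htp : IsCoprime t (p : ℤ))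
    (hk : k = 4 * Real.pi / (a + b) * ((t : ℝ) / (p : ℝ)))
    (hs : Real.sin (k * (a - b) / 2) ≠ 0) :
    ∃ (c : ℂ) (D : ℝ), c ≠ 0 ∧ ∀ n : ℕ,
      ‖∑ i ∈ Icc 1 n, Complex.exp (-(Complex.I * (k : ℂ) * (f a b (i : ℕ) : ℂ))) -
        c * expSum (xi p t) n‖ ≤ D := by
  set ξ := xi p t with hξ
  have hξn : ‖ξ‖ = 1 := norm_xi hp.pos t
  have hξ2 : ξ ^ 2 ≠ 1 := xi_sq_ne_one hp hp3 htp
  have hξ1 : 1 - ξ ≠ 0 := fun h => hξ2 (by rw [← sub_eq_zero.1 h, one_pow])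
  have hξ0 : ξ ≠ 0 := norm_ne_zero_iff.1 (by rw [hξn]; norm_num)
  have hsc : (Real.sin (k * (a - b) / 2) : ℂ) ≠ 0 := by exact_mod_cast hs
  set g : ℕ → ℂ := fun i => Complex.exp (-(Complex.I * (k : ℂ) * (f a b (i : ℕ) : ℂ))) with hg
  have hgn : ∀ i, ‖g i‖ = 1 := fun i => norm_exp_neg_I_mul _ _
  set A : ℂ := 1 + ξ * Real.cos (k * (a - b) / 2)
  -- The odd points produce -iξ sin(k(a-b)/2) ∑ η_m ξ^(2m); the divisor 1 - ξ comes from E_ξ(2M) =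
  -- (1 - ξ) E_{ξ²}(M). The remaining part is A times a geometric sum, bounded because ξ² ≠ 1.
  set c : ℂ := -Complex.I * ξ * Real.sin (k * (a - b) / 2) / (1 - ξ) with hc
  have heven : ∀ M : ℕ, ∑ i ∈ range (2 * M), g i =
      A * ∑ m ∈ range M, (ξ ^ 2) ^ m + c * expSum ξ (2 * M) := by
    intro M
    have h1 : c * expSum ξ (2 * M) =
        -Complex.I * ξ * Real.sin (k * (a - b) / 2) * expSum (ξ ^ 2) M := by
      rw [expSum_two_mul, hc]; field_simp
    rw [h1]
    induction M with
    | zero => simp [expSum]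
    | succ M ih =>
      rw [show 2 * (M + 1) = 2 * M + 1 + 1 by ring, sum_range_succ, sum_range_succ,
        ih (by rw [expSum_two_mul, hc]; field_simp), hg]
      simp only [exp_f_two_mul hab hk, exp_f_two_mul_add_one hab hk]
      rw [expSum, expSum, sum_range_succ, sum_range_succ]
      ring
  have hgeom : ∀ M : ℕ, ‖∑ m ∈ range M, (ξ ^ 2) ^ m‖ ≤ 2 / ‖ξ ^ 2 - 1‖ := by
    intro M
    rw [geom_sum_eq hξ2, norm_div]
    gcongr
    refine (norm_sub_le _ _).trans ?_
    simp [hξn]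
    norm_num
  have hstep : ∀ n : ℕ, ‖(∑ i ∈ range (n + 1), g i - c * expSum ξ (n + 1)) -
      (∑ i ∈ range n, g i - c * expSum ξ n)‖ ≤ 1 + ‖c‖ := by
    intro n
    have h1 : (∑ i ∈ range (n + 1), g i - c * expSum ξ (n + 1)) -
      (∑ i ∈ range n, g i - c * expSum ξ n) = g n - c * (eta n * ξ ^ n) := by
      rw [expSum, expSum, sum_range_succ, sum_range_succ]; ring
    rw [h1]
    refine (norm_sub_le _ _).trans ?_
    rw [hgn, norm_mul, norm_mul, norm_eta, norm_pow, hξn, one_pow, mul_one, mul_one]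
  have heb : ∀ M : ℕ, ‖∑ i ∈ range (2 * M), g i - c * expSum ξ (2 * M)‖ ≤
      ‖A‖ * (2 / ‖ξ ^ 2 - 1‖) := by
    intro M
    rw [heven, add_sub_cancel_right, norm_mul]
    gcongr
    exact hgeom M
  have hall : ∀ n : ℕ, ‖∑ i ∈ range n, g i - c * expSum ξ n‖ ≤
      ‖A‖ * (2 / ‖ξ ^ 2 - 1‖) + (1 + ‖c‖) := by
    intro n
    obtain ⟨M, rfl | rfl⟩ : ∃ M, n = 2 * M ∨ n = 2 * M + 1 := ⟨n / 2, by omega⟩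
    · exact (heb M).trans (le_add_of_nonneg_right (by positivity))
    · exact (norm_le_insert' _ _).trans (add_le_add (heb M) (hstep _))
  refine ⟨c, ‖A‖ * (2 / ‖ξ ^ 2 - 1‖) + (1 + ‖c‖) + 2, ?_, fun n => ?_⟩
  · exact div_ne_zero (mul_ne_zero (mul_ne_zero (neg_ne_zero.2 Complex.I_ne_zero) hξ0) hsc) hξ1
  · have h1 : ∑ i ∈ Icc 1 n, g i = ∑ i ∈ range n, g i + (g n - g 0) := by
      induction n with
      | zero => simp
      | succ n ih => rw [sum_Icc_succ_top (by omega), ih, sum_range_succ]; ring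
    rw [h1, add_sub_right_comm]
    refine (norm_add_le _ _).trans (add_le_add (hall n) ?_)
    refine (norm_sub_le _ _).trans ?_
    rw [hgn, hgn]; norm_num

/-- The structure factor has exact order `n^β`. -/
theorem exists_norm_sum_exp_bounds {a b k : ℝ} (hab : a + b ≠ 0) {t : ℤ} {p : ℕ} (hp : Odd p)
    (hp3 : 3 ≤ p) (htp : IsCoprime t (p : ℤ))
    (hk : k = 4 * Real.pi / (a + b) * ((t : ℝ) / (p : ℝ)))
    (hs : Real.sin (k * (a - b) / 2) ≠ 0) (hR : (0 : ℂ) ∉ rarefactionDomain p t) :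
    ∃ c C : ℝ, 0 < c ∧ ∀ᶠ n : ℕ in atTop,
      c * (n : ℝ) ^ beta p ≤
        ‖∑ i ∈ Icc 1 n, Complex.exp (-(Complex.I * (k : ℂ) * (f a b (i : ℕ) : ℂ)))‖ ∧
      ‖∑ i ∈ Icc 1 n, Complex.exp (-(Complex.I * (k : ℂ) * (f a b (i : ℕ) : ℂ)))‖ ≤
        C * (n : ℝ) ^ beta p := by
  obtain ⟨γ, D, hγ, hD⟩ := exists_norm_sum_exp_sub_le hab hp hp3 htp hk hs
  obtain ⟨c, C, hc, hcC⟩ := exists_norm_expSum_xi_bounds hp hp3 hR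
  have hγ0 : 0 < ‖γ‖ := norm_pos_iff.2 hγ
  -- Since β > 0, half of the main term eventually absorbs the bounded error D.
  have hβ : Tendsto (fun n : ℕ => ‖γ‖ * c / 2 * (n : ℝ) ^ beta p) atTop atTop :=
    ((tendsto_rpow_atTop (beta_mem_Ioo hp hp3).1).comp
      tendsto_natCast_atTop_atTop).const_mul_atTop (by positivity)
  refine ⟨‖γ‖ * c / 2, ‖γ‖ * C + ‖γ‖ * c / 2, by positivity, ?_⟩
  filter_upwards [hcC, hβ.eventually_ge_atTop D] with n hn hDn
  have h1 := (abs_le.1 ((abs_norm_sub_norm_le _ _).trans (hD n)))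
  rw [norm_mul] at h1
  have h2 := mul_le_mul_of_nonneg_left hn.1 hγ0.le
  have h3 := mul_le_mul_of_nonneg_left hn.2 hγ0.le
  constructor
  · linarith
  · linarith

end

/-! ### Approximants as initial segments, and the scaling exponent -/

noncomputable section
open Finset Filter Topology

theorem f_step_bounds {a b : ℝ} (hab : b < a) (n : ℕ) :
    b ≤ (a + b) / 2 + (a - b) / 2 * (eta n : ℝ) ∧ (a + b) / 2 + (a - b) / 2 * (eta n : ℝ) ≤ a := by
  rcases eta_eq_one_or n with h | h <;> rw [h] <;> push_cast <;> constructor <;> linarith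

theorem f_strictMono {a b : ℝ} (hb : 0 < b) (hab : b < a) :
    StrictMono fun n : ℕ => f a b n := by
  refine strictMono_nat_of_lt_succ fun n => ?_
  rw [f_natCast_succ]
  linarith [(f_step_bounds hab n).1]

theorem f_bounds {a b : ℝ} (hab : b < a) (n : ℕ) : b * n ≤ f a b n ∧ f a b n ≤ a * n := by
  induction n with
  | zero => simp [f]
  | succ n ih =>
    rw [f_natCast_succ]
    have := f_step_bounds hab n
    push_cast
    constructor <;> linarith [ih.1, ih.2]

theorem f_pos_iff {a b : ℝ} (hb : 0 < b) (hab : b < a) (n : ℤ) : 0 < f a b n ↔ 1 ≤ n := by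
  rcases le_or_gt n 0 with hn | hn
  · refine iff_of_false (not_lt.2 ?_) (by omega)
    unfold f
    refine mul_nonpos_of_nonpos_of_nonneg ?_ (sum_nonneg fun m _ => ?_)
    · exact_mod_cast Int.sign_nonpos_iff.2 hn
    · exact hb.le.trans (f_step_bounds hab m).1
  · refine iff_of_true ?_ hn
    obtain ⟨m, rfl⟩ := Int.eq_ofNat_of_zero_le hn.le
    have hm : (0 : ℝ) < m := by exact_mod_cast hn
    exact (mul_pos hb hm).trans_le (f_bounds hab m).1

/-- The number of points `f(n)`, `n ≥ 1`, that do not exceed `y`. -/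
def pointCount (a b y : ℝ) : ℕ :=
  open Classical in Nat.findGreatest (fun n : ℕ => f a b n ≤ y) ⌊y / b⌋₊

theorem f_le_iff_le_pointCount {a b y : ℝ} (hb : 0 < b) (hab : b < a) (hy : 0 ≤ y) (n : ℕ) :
    f a b n ≤ y ↔ n ≤ pointCount a b y := by
  classical
  constructor
  · intro h
    -- The search bound y/b is large enough because f(n) ≥ bn.
    refine Nat.le_findGreatest (Nat.le_floor ?_) h
    rw [le_div_iff₀ hb, mul_comm]
    exact (f_bounds hab n).1.trans h
  · intro h
    refine ((f_strictMono hb hab).monotone h).trans ?_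
    exact Nat.findGreatest_spec (P := fun n : ℕ => f a b n ≤ y) (Nat.zero_le _) (by simpa [f] using hy)

theorem tendsto_pointCount {a b : ℝ} (hb : 0 < b) (hab : b < a) :
    Tendsto (pointCount a b) atTop atTop := by
  refine tendsto_atTop.2 fun n => ?_
  filter_upwards [eventually_ge_atTop (a * n), eventually_ge_atTop 0] with y hy hy0
  exact (f_le_iff_le_pointCount hb hab hy0 n).1 ((f_bounds hab n).2.trans hy)

/-- All weighted points are positive and the left end of J is negative, so only the right end of the
dilated interval matters. -/
theorem mem_approximant_iff {a b : ℝ} (hb : 0 < b) (hab : b < a) (U : AveragingSequence) (l : ℕ)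
    (n : ℤ) : f a b n ∈ U.approximant a b l ↔
      n ∈ Icc (1 : ℤ) (pointCount a b (U.ρ l * U.hi)) := by
  have hρ := U.ρ_pos l
  have hy := mul_pos hρ U.hi_pos
  rw [mem_Icc]
  constructor
  · rintro ⟨⟨x, hx, hxn⟩, m, hm, hmn⟩
    have hm1 : 1 ≤ m := by
      by_contra h
      exact hm (by simp [weight, h])
    have hn1 : 1 ≤ n := by
      rw [← f_pos_iff hb hab, ← hmn, f_pos_iff hb hab]
      exact hm1
    refine ⟨hn1, ?_⟩
    obtain ⟨n, rfl⟩ := Int.eq_ofNat_of_zero_le (zero_le_one.trans hn1)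
    have hle : f a b n ≤ U.ρ l * U.hi := by
      rw [← hxn]
      exact mul_le_mul_of_nonneg_left hx.2 hρ.le
    exact_mod_cast (f_le_iff_le_pointCount hb hab hy.le n).1 hle
  · rintro ⟨hn1, hn⟩
    refine ⟨⟨f a b n / U.ρ l, ⟨?_, ?_⟩, mul_div_cancel₀ _ hρ.ne'⟩, n, ?_, rfl⟩
    · exact U.lo_neg.le.trans (div_nonneg ((f_pos_iff hb hab n).2 hn1).le hρ.le)
    · obtain ⟨n, rfl⟩ := Int.eq_ofNat_of_zero_le (zero_le_one.trans hn1)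
      rw [div_le_iff₀ hρ, mul_comm]
      exact (f_le_iff_le_pointCount hb hab hy.le n).2 (by exact_mod_cast hn)
    · simp [weight, hn1]

theorem sum_Icc_intCast {M : Type*} [AddCommMonoid M] (n : ℕ) (g : ℤ → M) :
    ∑ i ∈ Icc (1 : ℤ) n, g i = ∑ i ∈ Icc 1 n, g (i : ℕ) := by
  refine (sum_bij (fun (i : ℕ) _ => (i : ℤ)) ?_ ?_ ?_ ?_).symm
  · intro i hi
    rw [mem_Icc] at hi ⊢
    omega
  · intro i _ j _ h
    exact_mod_cast h
  · intro i hi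
    rw [mem_Icc] at hi
    exact ⟨i.toNat, by rw [mem_Icc]; omega, by omega⟩
  · intro i _
    rfl

theorem ncard_approximant {a b : ℝ} (hb : 0 < b) (hab : b < a) (U : AveragingSequence) (l : ℕ) :
    (U.approximant a b l).ncard = pointCount a b (U.ρ l * U.hi) := by
  have h : U.approximant a b l =
      ((fun n : ℕ => f a b n) '' (Icc 1 (pointCount a b (U.ρ l * U.hi)) : Finset ℕ)) := by
    ext x
    constructor
    · intro hx
      obtain ⟨n, -, rfl⟩ := hx.2
      have hn := mem_Icc.1 ((mem_approximant_iff hb hab U l n).1 hx)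
      obtain ⟨m, rfl⟩ := Int.eq_ofNat_of_zero_le (zero_le_one.trans hn.1)
      exact ⟨m, by rw [coe_Icc, Set.mem_Icc]; omega, rfl⟩
    · rintro ⟨n, hn, rfl⟩
      rw [coe_Icc, Set.mem_Icc] at hn
      exact (mem_approximant_iff hb hab U l n).2 (mem_Icc.2 (by omega))
  rw [h, Set.ncard_image_of_injective _ (f_strictMono hb hab).injective, Set.ncard_coe_finset,
    Nat.card_Icc, Nat.add_sub_cancel]

theorem nuNormalized_eq {a b : ℝ} (hb : 0 < b) (hab : b < a) (U : AveragingSequence)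
    (α : ℝ) (l : ℕ) (k : ℝ) :
    nuNormalized a b U α l k = 1 / (pointCount a b (U.ρ l * U.hi) : ℝ) *
      ‖∑ i ∈ Icc 1 (pointCount a b (U.ρ l * U.hi)),
        Complex.exp (-(Complex.I * (k : ℂ) * (f a b (i : ℕ) : ℂ)))‖ ^ 2 /
      (pointCount a b (U.ρ l * U.hi) : ℝ) ^ α := by
  have h : (∑ᶠ (n : ℤ) (_ : f a b n ∈ U.approximant a b l),
      weight n * Complex.exp (-(Complex.I * (k : ℂ) * (f a b n : ℂ)))) =
      ∑ i ∈ Icc 1 (pointCount a b (U.ρ l * U.hi)),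
        Complex.exp (-(Complex.I * (k : ℂ) * (f a b (i : ℕ) : ℂ))) := by
    simp only [mem_approximant_iff hb hab]
    rw [finsum_mem_finset_eq_sum, sum_Icc_intCast]
    refine sum_congr rfl fun i hi => ?_
    have : (1 : ℤ) ≤ i := by exact_mod_cast (mem_Icc.1 hi).1
    rw [weight, if_pos this, one_mul]
  rw [nuNormalized, nu, h, ncard_approximant hb hab]

theorem tendsto_pointCount_averaging {a b : ℝ} (hb : 0 < b) (hab : b < a)
    (U : AveragingSequence) :
    Tendsto (fun l => pointCount a b (U.ρ l * U.hi)) atTop atTop :=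
  (tendsto_pointCount hb hab).comp (U.ρ_tendsto.atTop_mul_const U.hi_pos)

/-- If the structure factor has exact order `n^β`, the normalized densities for the exponent `α'`
have exact order `card ^ (2β - 1 - α')`. -/
theorem eventually_nuNormalized_bounds {a b k β c C : ℝ} (hb : 0 < b) (hab : b < a) (hc : 0 < c)
    (h : ∀ᶠ n : ℕ in atTop,
      c * (n : ℝ) ^ β ≤
        ‖∑ i ∈ Icc 1 n, Complex.exp (-(Complex.I * (k : ℂ) * (f a b (i : ℕ) : ℂ)))‖ ∧
      ‖∑ i ∈ Icc 1 n, Complex.exp (-(Complex.I * (k : ℂ) * (f a b (i : ℕ) : ℂ)))‖ ≤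
        C * (n : ℝ) ^ β) (U : AveragingSequence) (α : ℝ) :
    ∀ᶠ l in atTop,
      c ^ 2 * (pointCount a b (U.ρ l * U.hi) : ℝ) ^ (2 * β - 1 - α) ≤ nuNormalized a b U α l k ∧
      nuNormalized a b U α l k ≤
        C ^ 2 * (pointCount a b (U.ρ l * U.hi) : ℝ) ^ (2 * β - 1 - α) := by
  filter_upwards [(tendsto_pointCount_averaging hb hab U).eventually h,
    (tendsto_pointCount_averaging hb hab U).eventually_ge_atTop 1] with l hl hl1
  rw [nuNormalized_eq hb hab]
  set n := pointCount a b (U.ρ l * U.hi)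
  have hn : (0 : ℝ) < n := by exact_mod_cast hl1
  have hpow : ∀ d : ℝ, d ^ 2 * (n : ℝ) ^ (2 * β - 1 - α) =
      1 / (n : ℝ) * (d * (n : ℝ) ^ β) ^ 2 / (n : ℝ) ^ α := by
    intro d
    rw [Real.rpow_sub hn, Real.rpow_sub_one hn.ne', two_mul, Real.rpow_add hn]
    ring
  rw [hpow, hpow]
  have hcn : 0 ≤ c * (n : ℝ) ^ β := by positivity
  constructor
  · gcongr
    exact hl.1
  · gcongr
    exact hl.2

/-- Exact order `n^β` of the structure factor makes `2β - 1` the only scaling exponent. -/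
theorem isAGLExponent_unique_of_bounds {a b k β c C : ℝ} (hb : 0 < b) (hab : b < a) (hc : 0 < c)
    (hβ : β ∈ Set.Ioo (0 : ℝ) 1)
    (h : ∀ᶠ n : ℕ in atTop,
      c * (n : ℝ) ^ β ≤
        ‖∑ i ∈ Icc 1 n, Complex.exp (-(Complex.I * (k : ℂ) * (f a b (i : ℕ) : ℂ)))‖ ∧
      ‖∑ i ∈ Icc 1 n, Complex.exp (-(Complex.I * (k : ℂ) * (f a b (i : ℕ) : ℂ)))‖ ≤
        C * (n : ℝ) ^ β) :
    (IsAGLExponent a b k (2 * β - 1) ∧ ∀ α : ℝ, IsAGLExponent a b k α → α = 2 * β - 1) ∧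
      ¬ ∃ V : AveragingSequence, HasExtinctionProperty a b k (2 * β - 1) V := by
  have hbd : ∀ U : AveragingSequence, ∀ᶠ l in atTop,
      c ^ 2 ≤ nuNormalized a b U (2 * β - 1) l k ∧
        nuNormalized a b U (2 * β - 1) l k ≤ C ^ 2 := fun U => by
    simpa using eventually_nuNormalized_bounds hb hab hc h U (2 * β - 1)
  refine ⟨⟨⟨⟨by linarith [hβ.1], by linarith [hβ.2]⟩, fun U => ?_⟩, fun α hα => ?_⟩, ?_⟩
  · intro inf sup
    have h1 : ENNReal.ofReal (c ^ 2) ≤ inf :=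
      le_liminf_of_le (by isBoundedDefault)
        ((hbd U).mono fun l hl => ENNReal.ofReal_le_ofReal hl.1)
    have h2 : sup ≤ ENNReal.ofReal (C ^ 2) :=
      limsup_le_of_le (by isBoundedDefault)
        ((hbd U).mono fun l hl => ENNReal.ofReal_le_ofReal hl.2)
    have h3 : inf ≤ sup := liminf_le_limsup
    have h4 : 0 < inf := (ENNReal.ofReal_pos.2 (by positivity)).trans_le h1
    have h5 : sup < ⊤ := h2.trans_lt ENNReal.ofReal_lt_top
    exact ⟨fun _ => ⟨h4, h3, h5⟩, fun _ => ⟨h4.trans_le h3, h5⟩⟩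
  -- One test sequence suffices for uniqueness: a smaller α forces an infinite upper limit, and a
  -- larger α makes both limits 0. Either contradicts the definition.
  · let U : AveragingSequence :=
      { lo := -1
        hi := 1
        lo_neg := by norm_num
        hi_pos := one_pos
        ρ := fun l => (l : ℝ) + 1
        ρ_pos := fun l => by positivity
        ρ_strictMono := fun i j hij => by simpa using hij
        ρ_tendsto := tendsto_atTop_add_const_right _ _ tendsto_natCast_atTop_atTop }
    obtain ⟨hne, heq⟩ := hα.2 U
    have hbU := eventually_nuNormalized_bounds hb hab hc h U α
    have hN : Tendsto (fun l => (pointCount a b (U.ρ l * U.hi) : ℝ)) atTop atTop :=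
      tendsto_natCast_atTop_atTop.comp (tendsto_pointCount_averaging hb hab U)
    rcases lt_trichotomy α (2 * β - 1) with hlt | rfl | hgt
    · exfalso
      have hT : Tendsto (fun l => nuNormalized a b U α l k) atTop atTop :=
        tendsto_atTop_mono' _ (hbU.mono fun l hl => hl.1)
          (((tendsto_rpow_atTop (sub_pos.2 hlt)).comp hN).const_mul_atTop (by positivity))
      have hsup := (ENNReal.tendsto_ofReal_atTop.comp hT).limsup_eq
      simp only [Function.comp_def] at hsup
      rw [hsup] at hne heq
      by_cases h0 : liminf (fun l => ENNReal.ofReal (nuNormalized a b U α l k)) atTop = 0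
      · exact (heq h0).2.ne rfl
      · exact (hne h0).2.2.ne rfl
    · rfl
    · exfalso
      have hz : Tendsto (fun l => C ^ 2 *
          (pointCount a b (U.ρ l * U.hi) : ℝ) ^ (2 * β - 1 - α)) atTop (𝓝 0) := by
        have := ((tendsto_rpow_neg_atTop (sub_pos.2 hgt)).comp hN).const_mul (C ^ 2)
        simpa [Function.comp_def] using this
      have hT : Tendsto (fun l => nuNormalized a b U α l k) atTop (𝓝 0) :=
        squeeze_zero' (hbU.mono fun l hl => le_trans (by positivity) hl.1)
          (hbU.mono fun l hl => hl.2) hz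
      have hE := ENNReal.tendsto_ofReal hT
      rw [ENNReal.ofReal_zero] at hE
      have h1 := (heq hE.liminf_eq).1
      rw [hE.limsup_eq] at h1
      exact h1.ne rfl
  · rintro ⟨V, hV⟩
    have hlt := hV.eventually (gt_mem_nhds (show (0 : ℝ) < c ^ 2 by positivity))
    obtain ⟨l, h1, h2⟩ := (hlt.and (hbd V)).exists
    exact h1.not_ge h2.1

end

end ThueMorse

theorem mainTheorem9 (a b : ℝ) (hb : 0 < b) (hab : b < a)
    (t : ℤ) (p : ℕ) (hp : Odd p) (hp3 : 3 ≤ p) (htp : IsCoprime t (p : ℤ))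
    (k : ℝ) (hk : k = 4 * Real.pi / (a + b) * ((t : ℝ) / (p : ℝ)))
    (hkS : k ∈ ThueMorse.singularSet a b)
    (hR : (0 : ℂ) ∉ ThueMorse.rarefactionDomain p t) :
    (ThueMorse.IsAGLExponent a b k (ThueMorse.alpha p) ∧
      ∀ α : ℝ, ThueMorse.IsAGLExponent a b k α → α = ThueMorse.alpha p) ∧
    ¬ ∃ V : ThueMorse.AveragingSequence,
      ThueMorse.HasExtinctionProperty a b k (ThueMorse.alpha p) V := by
  obtain ⟨_, _, _, _, _, _, _, hκ⟩ := hkS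
  obtain ⟨c, C, hc, hcC⟩ := ThueMorse.exists_norm_sum_exp_bounds (by linarith) hp hp3 htp hk
    (ThueMorse.sin_ne_zero_of_kappaEta_ne_zero hκ) hR
  exact ThueMorse.isAGLExponent_unique_of_bounds hb hab hc (ThueMorse.beta_mem_Ioo hp hp3) hcC
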